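/- Let $p\ge 2$ and let $n_i,s_i,t_i$ ($1\le i\le p$) be positive integers such that $n_i\ge s_i+t_i+1$ and $2\le s_i,t_i\le \frac{n_i}{2}$ for every $i$, and $n_i\le\frac74 n_j$ for all $i\ne j$. Let $S_1,\dots,S_p$ be pairwise disjoint sets with $|S_i|=n_i$, and for $k=(k_1,\dots,k_p)$ let $\prod_{i=1}^p\binom{[n_i]}{k_i}$ denote the family of all subsets $F\subseteq S_1\sqcup\dots\sqcup S_p$ with $|F\cap S_i|=k_i$ for every $i$. Suppose that $\prod_{i=1}^p\binom{n_i}{s_i}\ge\prod_{i=1}^p\binom{n_i}{t_i}$, and let $\mathcal A\subseteq\prod_{i=1}^p\binom{[n_i]}{t_i}$ and $\mathcal B\subseteq\prod_{i=1}^p\binom{[n_i]}{s_i}$ be non-empty families that are cross-intersecting, i.e. $A\cap B\ne\emptyset$ for all $A\in\mathcal A$ and $B\in\mathcal B$. Then $$|\mathcal A|+|\mathcal B|\le\prod_{i=1}^p\binom{n_i}{s_i}-\prod_{i=1}^p\binom{n_i-t_i}{s_i}+1,$$ and equality holds if and only if at least one of the following holds: (i) $\mathcal A=\{A\}$ and $\mathcal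 B=\{B\in\prod_{i=1}^p\binom{[n_i]}{s_i}: B\cap A\ne\emptyset\}$ for some $A\in\prod_{i=1}^p\binom{[n_i]}{t_i}$; (ii) $\prod_{i=1}^p\binom{n_i}{s_i}=\prod_{i=1}^p\binom{n_i}{t_i}$, and $\mathcal B=\{B\}$ and $\mathcal A=\{A\in\prod_{i=1}^p\binom{[n_i]}{t_i}: B\cap A\ne\emptyset\}$ for some $B\in\prod_{i=1}^p\binom{[n_i]}{s_i}$. -/

import Mathlib

/-- The family `∏ i, ([n i] choose k i)`: all subsets of the disjoint union of the parts
`[n i]`, `i : Fin p`, which have exactly `k i` elements in the `i`-th part for every `i`. -/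
def multiPart {p : ℕ} (n k : Fin p → ℕ) : Finset (Finset (Σ i : Fin p, Fin (n i))) :=
  Finset.univ.filter fun F => ∀ i : Fin p, (F.filter fun x => x.1 = i).card = k i

/-- Two families of sets are cross-intersecting if every member of the first meets every
member of the second. -/
def CrossIntersecting {α : Type*} [DecidableEq α] (𝒜 ℬ : Finset (Finset α)) : Prop :=
  ∀ A ∈ 𝒜, ∀ B ∈ ℬ, (A ∩ B).Nonempty

/-!
The proof works with the weight `|Y| |𝒜| + |X| |ℬ|` instead of `|𝒜| + |ℬ|`, where
`X = multiPart n t` and `Y = multiPart n s`. This weight is symmetric in the two sides, and it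
suffices to show that a cross-intersecting pair of families with at least two members each weighs
strictly less than the heavier of the two kinds of pairs formed by a single set and all sets meeting
it (`CrossIntersecting.pairWeight_add_lt`); the bound on `|𝒜| + |ℬ|` and its equality cases
follow from `|X| ≤ |Y|`.

Suppose this fails, and among the heaviest pairs choose one, `(A, B)`, whose less dense side is as
small as possible; by symmetry this side is `A` (`IsMinimalOptimal`). If `τ` swaps two points of one
part, then `(A ∩ τA, B ∪ τB)` and `(A ∪ τA, B ∩ τB)` are cross-intersecting as well. Since the weight
is modular and `A` is not denser than `B`, both are heaviest pairs as soon as `A` meets `τA`. By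
minimality either `τA = A`, or `A` and `τA` have at most one common member. There are two cases.

* Some `τ` fixes a member `a` of `A` but `τA ≠ A`. Then every set in `Y` meeting `a` is in `B ∪ τB`,
  which forces every other member of `A` to arise from `a` by exchanging one and the same element.
  So `A` is too small compared with the number of sets disjoint from two of its members
  (`IsMinimalOptimal.weight_add_lt_of_exchange`).
* Every `τ` that fixes a member of `A` preserves `A`. Let `I` be the set of parts all of whose
  swaps preserve `A`. In any other part, two members of `A` have equal or complementary traces
  (`IsMinimalOptimal.eq_or_compl`). Hence a set in `Y` is disjoint outside `I` from the traces of at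
  most one class of members of `A`, and a double count bounds the number of sets disjoint from some
  member of `A` (`IsMinimalOptimal.weight_add_le_of_invariant`). The remaining inequality between
  binomial coefficients is `prod_choose_mul_pred_ge`; only here do the ratios of the `n i` matter.
-/

open Finset

/-! ### Counting in products of layers -/

theorem mem_multiPart {p : ℕ} {n k : Fin p → ℕ} {F : Finset (Σ i : Fin p, Fin (n i))} :
    F ∈ multiPart n k ↔ ∀ i, #{x ∈ F | x.1 = i} = k i := by
  simp [multiPart]

theorem card_filter_fst_eq {p : ℕ} {n : Fin p → ℕ} (Z : Finset (Σ i : Fin p, Fin (n i)))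
    (i : Fin p) : #{x ∈ Z | x.1 = i} = #{y : Fin (n i) | (⟨i, y⟩ : Σ i, Fin (n i)) ∈ Z} := by
  symm
  refine card_bij (fun y _ => ⟨i, y⟩) (by simp) (by simp) ?_
  rintro ⟨j, y⟩ h
  obtain ⟨h1, rfl⟩ := mem_filter.1 h
  exact ⟨y, by simpa using h1, rfl⟩

theorem card_eq_of_mem_multiPart {p : ℕ} {n k : Fin p → ℕ}
    {F : Finset (Σ i : Fin p, Fin (n i))} (hF : F ∈ multiPart n k) : #F = ∑ i, k i := by
  rw [card_eq_sum_card_fiberwise (f := Sigma.fst) (t := univ) (by simp)]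
  exact sum_congr rfl fun i _ => mem_multiPart.1 hF i

/-- A member of `multiPart n k` disjoint from `Z` is an independent choice, in every part, of `k i`
of the elements outside `Z`. -/
theorem card_filter_disjoint {p : ℕ} (n k : Fin p → ℕ) (Z : Finset (Σ i : Fin p, Fin (n i))) :
    #{F ∈ multiPart n k | Disjoint F Z} =
      ∏ i, (n i - #{x ∈ Z | x.1 = i}).choose (k i) := by
  have h : ∀ i, (n i - #{x ∈ Z | x.1 = i}).choose (k i) =
      #(powersetCard (k i) {y : Fin (n i) | (⟨i, y⟩ : Σ i, Fin (n i)) ∉ Z}) := by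
    intro i
    rw [card_powersetCard, card_filter_fst_eq, ← compl_filter, card_compl, Fintype.card_fin]
  simp_rw [h]
  rw [← Fintype.card_piFinset]
  refine card_nbij' (fun F i => ({y : Fin (n i) | (⟨i, y⟩ : Σ i, Fin (n i)) ∈ F} : Finset _))
    (fun f => univ.sigma f) ?_ ?_ ?_ ?_
  · intro F hF
    simp only [coe_filter, Set.mem_ofPred_eq, mem_multiPart, disjoint_left] at hF
    simp only [mem_coe, Fintype.mem_piFinset, mem_powersetCard]
    intro i
    refine ⟨fun y hy => ?_, ?_⟩
    · simp only [mem_filter, mem_univ, true_and] at hy ⊢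
      exact hF.2 hy
    · rw [← card_filter_fst_eq, hF.1]
  · intro f hf
    simp only [mem_coe, Fintype.mem_piFinset, mem_powersetCard] at hf
    simp only [coe_filter, Set.mem_ofPred_eq, mem_multiPart, disjoint_left]
    refine ⟨fun i => ?_, ?_⟩
    · rw [card_filter_fst_eq]
      rw [← (hf i).2]
      congr 1
      ext y
      simp
    · rintro ⟨i, y⟩ hy
      have := (hf i).1 (by simpa using hy)
      simpa using this
  · intro F _
    ext ⟨i, y⟩
    simp
  · intro f _
    funext i
    ext y
    simp

theorem card_multiPart {p : ℕ} (n k : Fin p → ℕ) :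
    #(multiPart n k) = ∏ i, (n i).choose (k i) := by
  have := card_filter_disjoint n k ∅
  simpa using this

theorem card_filter_disjoint_of_mem {p : ℕ} {n k l : Fin p → ℕ}
    {G : Finset (Σ i : Fin p, Fin (n i))} (hG : G ∈ multiPart n l) :
    #{F ∈ multiPart n k | Disjoint F G} = ∏ i, (n i - l i).choose (k i) := by
  rw [card_filter_disjoint]
  simp_rw [mem_multiPart.1 hG]

theorem choose_mul_choose_swap {n s t : ℕ} (h : s + t ≤ n) :
    n.choose t * (n - t).choose s = n.choose s * (n - s).choose t := by
  have h1 := Nat.choose_mul_factorial_mul_factorial (n := n) (k := t) (by omega)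
  have h2 := Nat.choose_mul_factorial_mul_factorial (n := n) (k := s) (by omega)
  have h3 := Nat.choose_mul_factorial_mul_factorial (n := n - t) (k := s) (by omega)
  have h4 := Nat.choose_mul_factorial_mul_factorial (n := n - s) (k := t) (by omega)
  rw [← h3] at h1
  rw [← h4, show n - s - t = n - t - s by omega] at h2
  have h5 : 0 < s.factorial * t.factorial * (n - t - s).factorial := by positivity
  apply Nat.eq_of_mul_eq_mul_right h5
  calc _ = n.choose t * t.factorial *
        ((n - t).choose s * s.factorial * (n - t - s).factorial) := by ring
    _ = n.choose s * s.factorial *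
        ((n - s).choose t * t.factorial * (n - t - s).factorial) := by rw [h1, h2]
    _ = _ := by ring

/-- Both sides count the disjoint pairs of members of `multiPart n t` and `multiPart n s`. -/
theorem card_mul_card_filter_disjoint {p : ℕ} {n s t : Fin p → ℕ}
    (hnst : ∀ i, s i + t i + 1 ≤ n i) :
    #(multiPart n t) * ∏ i, (n i - t i).choose (s i) =
      #(multiPart n s) * ∏ i, (n i - s i).choose (t i) := by
  rw [card_multiPart, card_multiPart, ← prod_mul_distrib, ← prod_mul_distrib]
  exact prod_congr rfl fun i _ => choose_mul_choose_swap (by have := hnst i; omega)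

/-! ### Swapping two points -/

/-- The image of a set under the transposition of `u` and `v`. -/
def swapSet {α : Type*} [DecidableEq α] (u v : α) (a : Finset α) : Finset α :=
  a.map (Equiv.swap u v).toEmbedding

theorem mem_swapSet {α : Type*} [DecidableEq α] {u v x : α} {a : Finset α} :
    x ∈ swapSet u v a ↔ Equiv.swap u v x ∈ a := by
  simp [swapSet, Finset.mem_map_equiv]

theorem swapSet_swapSet {α : Type*} [DecidableEq α] (u v : α) (a : Finset α) :
    swapSet u v (swapSet u v a) = a := by
  ext x; simp [mem_swapSet]

theorem disjoint_swapSet {α : Type*} [DecidableEq α] {u v : α} {a b : Finset α} :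
    Disjoint (swapSet u v a) (swapSet u v b) ↔ Disjoint a b := by
  simp [swapSet]

theorem swapSet_eq_self {α : Type*} [DecidableEq α] {u v : α} {a : Finset α}
    (h : u ∈ a ↔ v ∈ a) : swapSet u v a = a := by
  ext x
  rw [mem_swapSet, Equiv.swap_apply_def]
  split_ifs <;> simp_all

theorem mem_iff_of_swapSet_eq_self {α : Type*} [DecidableEq α] {u v : α} {a : Finset α}
    (h : swapSet u v a = a) : u ∈ a ↔ v ∈ a := by
  have : u ∈ swapSet u v a ↔ u ∈ a := by rw [h]
  rw [mem_swapSet, Equiv.swap_apply_left] at this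
  exact this.symm

/-- The family of all images of members of `A` under the transposition of `u` and `v`. -/
def swapFamily {α : Type*} [DecidableEq α] (u v : α) (A : Finset (Finset α)) :
    Finset (Finset α) :=
  A.image (swapSet u v)

theorem mem_swapFamily {α : Type*} [DecidableEq α] {u v : α} {A : Finset (Finset α)}
    {a : Finset α} : a ∈ swapFamily u v A ↔ swapSet u v a ∈ A := by
  simp only [swapFamily, mem_image]
  constructor
  · rintro ⟨b, hb, rfl⟩
    rwa [swapSet_swapSet]
  · exact fun h => ⟨_, h, swapSet_swapSet ..⟩

theorem card_swapFamily {α : Type*} [DecidableEq α] (u v : α) (A : Finset (Finset α)) :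
    #(swapFamily u v A) = #A :=
  card_image_of_injective _ (Function.LeftInverse.injective (swapSet_swapSet u v))

theorem swapFamily_comm {α : Type*} [DecidableEq α] (u v : α) (A : Finset (Finset α)) :
    swapFamily u v A = swapFamily v u A := by
  ext x
  simp [mem_swapFamily, swapSet, Equiv.swap_comm u v]

theorem swapSet_mem_multiPart {p : ℕ} {n k : Fin p → ℕ} {u v : Σ i : Fin p, Fin (n i)}
    (huv : u.1 = v.1) {F : Finset (Σ i : Fin p, Fin (n i))} :
    swapSet u v F ∈ multiPart n k ↔ F ∈ multiPart n k := by
  simp only [mem_multiPart]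
  refine forall_congr' fun i => ?_
  have : #{x ∈ swapSet u v F | x.1 = i} = #{x ∈ F | x.1 = i} := by
    refine card_nbij' (Equiv.swap u v) (Equiv.swap u v) ?_ ?_ (by intro x _; simp)
      (by intro x _; simp)
    all_goals
      intro x hx
      simp only [coe_filter, Set.mem_ofPred_eq, mem_swapSet, Equiv.swap_apply_self] at hx ⊢
      refine ⟨hx.1, ?_⟩
      rw [Equiv.swap_apply_def]
      split_ifs <;> simp_all
  rw [this]

theorem swapFamily_subset_multiPart {p : ℕ} {n k : Fin p → ℕ} {u v : Σ i : Fin p, Fin (n i)}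
    (huv : u.1 = v.1) {A : Finset (Finset (Σ i : Fin p, Fin (n i)))}
    (hA : A ⊆ multiPart n k) : swapFamily u v A ⊆ multiPart n k := fun _ ha =>
  (swapSet_mem_multiPart huv).1 (hA (mem_swapFamily.1 ha))

/-! ### Extremal cross-intersecting pairs -/

theorem crossIntersecting_iff {α : Type*} [DecidableEq α] {A B : Finset (Finset α)} :
    CrossIntersecting A B ↔ ∀ a ∈ A, ∀ b ∈ B, ¬ Disjoint a b := by
  simp [CrossIntersecting, not_disjoint_iff_nonempty_inter]

theorem CrossIntersecting.symm {α : Type*} [DecidableEq α] {A B : Finset (Finset α)}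
    (h : CrossIntersecting A B) : CrossIntersecting B A := fun b hb a ha => by
  rw [inter_comm]; exact h a ha b hb

theorem CrossIntersecting.swapFamily {α : Type*} [DecidableEq α] {A B : Finset (Finset α)}
    (h : CrossIntersecting A B) (u v : α) :
    CrossIntersecting (swapFamily u v A) (swapFamily u v B) := by
  rw [crossIntersecting_iff] at h ⊢
  intro a ha b hb hab
  exact h _ (mem_swapFamily.1 ha) _ (mem_swapFamily.1 hb) (disjoint_swapSet.2 hab)

theorem CrossIntersecting.inter_union {α : Type*} [DecidableEq α]
    {A B A' B' : Finset (Finset α)}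
    (h : CrossIntersecting A B) (h' : CrossIntersecting A' B') :
    CrossIntersecting (A ∩ A') (B ∪ B') := by
  intro a ha b hb
  rw [mem_inter] at ha
  rcases mem_union.1 hb with hb | hb
  · exact h a ha.1 b hb
  · exact h' a ha.2 b hb

theorem CrossIntersecting.union_inter {α : Type*} [DecidableEq α]
    {A B A' B' : Finset (Finset α)}
    (h : CrossIntersecting A B) (h' : CrossIntersecting A' B') :
    CrossIntersecting (A ∪ A') (B ∩ B') :=
  (h.symm.inter_union h'.symm).symm

/-- The weight `|Y| |A| + |X| |B|` of a pair of families `A ⊆ X`, `B ⊆ Y`: up to the factor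
`|X| |Y|`, the sum of the densities of `A` in `X` and of `B` in `Y`. Unlike `|A| + |B|` it treats
the two sides symmetrically even if `|X| ≠ |Y|`. -/
def pairWeight {α : Type*} (X Y A B : Finset (Finset α)) : ℕ := #Y * #A + #X * #B

/-- A pair of families `A ⊆ multiPart n t`, `B ⊆ multiPart n s`, both with at least two members,
which has maximum weight among all cross-intersecting pairs of non-empty families, in which `A`
is smallest among the pairs of this kind, and in which `A` is not denser than `B`. -/
structure IsMinimalOptimal {p : ℕ} (n t s : Fin p → ℕ)
    (A B : Finset (Finset (Σ i : Fin p, Fin (n i)))) : Prop where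
  subset_left : A ⊆ multiPart n t
  subset_right : B ⊆ multiPart n s
  cross : CrossIntersecting A B
  two_le_left : 2 ≤ #A
  two_le_right : 2 ≤ #B
  weight_le : ∀ A' ⊆ multiPart n t, ∀ B' ⊆ multiPart n s, A'.Nonempty → B'.Nonempty →
    CrossIntersecting A' B' → pairWeight (multiPart n t) (multiPart n s) A' B' ≤
      pairWeight (multiPart n t) (multiPart n s) A B
  card_le : ∀ A' ⊆ multiPart n t, ∀ B' ⊆ multiPart n s, 2 ≤ #A' → 2 ≤ #B' →
    CrossIntersecting A' B' → pairWeight (multiPart n t) (multiPart n s) A' B' =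
      pairWeight (multiPart n t) (multiPart n s) A B → #A ≤ #A'
  density_le : #(multiPart n s) * #A ≤ #(multiPart n t) * #B

namespace IsMinimalOptimal

variable {p : ℕ} {n t s : Fin p → ℕ} {A B : Finset (Finset (Σ i : Fin p, Fin (n i)))}
  {u v : Σ i : Fin p, Fin (n i)}

/-- Weight is modular, so that intersecting `A` with an image of it (and uniting the images of
`B`) keeps the weight at its maximum. -/
theorem weight_inter_union (h : IsMinimalOptimal n t s A B) (huv : u.1 = v.1)
    (hne : (A ∩ swapFamily u v A).Nonempty) :
    pairWeight (multiPart n t) (multiPart n s) (A ∩ swapFamily u v A) (B ∪ swapFamily u v B) =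
      pairWeight (multiPart n t) (multiPart n s) A B := by
  have hA' := swapFamily_subset_multiPart huv h.subset_left
  have hB' := swapFamily_subset_multiPart huv h.subset_right
  have hc := h.cross.swapFamily u v
  have hBne : B.Nonempty := card_pos.1 (by have := h.two_le_right; omega)
  have h1 := h.weight_le _ (inter_subset_left.trans h.subset_left) _
    (union_subset h.subset_right hB') hne (hBne.mono subset_union_left) (h.cross.inter_union hc)
  have eA := card_union_add_card_inter A (swapFamily u v A)
  have eB := card_union_add_card_inter B (swapFamily u v B)
  rw [card_swapFamily] at eA eB
  have hX : 0 < #(multiPart n s) := by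
    obtain ⟨b, hb⟩ := hBne
    exact card_pos.2 ⟨b, h.subset_right hb⟩
  -- If `B` were disjoint from its image, the weight of the new pair would be too large.
  have hne' : (B ∩ swapFamily u v B).Nonempty := by
    rw [nonempty_iff_ne_empty]
    intro h0
    rw [h0, card_empty] at eB
    simp only [pairWeight] at h1
    have := h.density_le
    have e2 : #(B ∪ swapFamily u v B) = 2 * #B := by omega
    rw [e2] at h1
    have : 0 < #(multiPart n s) * #(A ∩ swapFamily u v A) := Nat.mul_pos hX hne.card_pos
    nlinarith
  have h2 := h.weight_le _ (union_subset h.subset_left hA') _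
    (inter_subset_left.trans h.subset_right) (hne.mono (inter_subset_left.trans subset_union_left))
    hne' (h.cross.union_inter hc)
  simp only [pairWeight] at h1 h2 ⊢
  nlinarith

/-- If `A` and its image under a swap share two members, then `A` minimal forces them to be equal. -/
theorem swapFamily_eq_self (h : IsMinimalOptimal n t s A B) (huv : u.1 = v.1)
    (h2 : 2 ≤ #(A ∩ swapFamily u v A)) : swapFamily u v A = A := by
  have hw := h.weight_inter_union huv (card_pos.1 (by omega))
  have hB' := swapFamily_subset_multiPart huv h.subset_right
  have hle := h.card_le _ (inter_subset_left.trans h.subset_left) _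
    (union_subset h.subset_right hB') h2
    (h.two_le_right.trans (card_le_card subset_union_left))
    (h.cross.inter_union (h.cross.swapFamily u v)) hw
  have e1 := eq_of_subset_of_card_le inter_subset_left hle
  exact (eq_of_subset_of_card_le (inter_eq_left.1 e1) (card_swapFamily u v A).le).symm

theorem swapFamily_eq_self_of_mem (h : IsMinimalOptimal n t s A B) (huv : u.1 = v.1)
    {a b : Finset (Σ i : Fin p, Fin (n i))} (hab : a ≠ b) (ha : a ∈ A) (hb : b ∈ A)
    (ha' : swapSet u v a ∈ A) (hb' : swapSet u v b ∈ A) : swapFamily u v A = A := by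
  refine h.swapFamily_eq_self huv ?_
  rw [← card_pair hab]
  refine card_le_card ?_
  intro x hx
  rw [mem_inter, mem_swapFamily]
  rcases mem_insert.1 hx with rfl | hx
  · exact ⟨ha, ha'⟩
  · rw [mem_singleton.1 hx]; exact ⟨hb, hb'⟩

/-- If `a` is fixed by a swap that does not preserve `A`, then `A` and its image meet in `{a}` only, so
that `{a}` together with `B` and its image is a pair of maximum weight; hence the latter two exhaust
the sets that meet `a`. -/
theorem mem_or_mem_of_not_disjoint (h : IsMinimalOptimal n t s A B) (huv : u.1 = v.1)
    {a : Finset (Σ i : Fin p, Fin (n i))} (ha : a ∈ A) (hfix : swapSet u v a = a)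
    (hne : swapFamily u v A ≠ A) {b : Finset (Σ i : Fin p, Fin (n i))}
    (hb : b ∈ multiPart n s) (hab : ¬ Disjoint a b) : b ∈ B ∨ swapSet u v b ∈ B := by
  have hmem : a ∈ A ∩ swapFamily u v A := by
    rw [mem_inter, mem_swapFamily, hfix]; exact ⟨ha, ha⟩
  have h1 : A ∩ swapFamily u v A = {a} := by
    by_contra hcon
    refine hne (h.swapFamily_eq_self huv ?_)
    have : 0 < #(A ∩ swapFamily u v A) := card_pos.2 ⟨a, hmem⟩
    by_contra hlt
    obtain ⟨c, hc⟩ := card_eq_one.1 (show #(A ∩ swapFamily u v A) = 1 by omega)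
    rw [hc, mem_singleton] at hmem
    exact hcon (hmem ▸ hc)
  have hw := h.weight_inter_union huv ⟨a, hmem⟩
  rw [h1] at hw
  have hB' := swapFamily_subset_multiPart huv h.subset_right
  have hsub : B ∪ swapFamily u v B ⊆ {b ∈ multiPart n s | ¬ Disjoint a b} := by
    intro c hc
    rw [mem_filter]
    refine ⟨union_subset h.subset_right hB' hc, ?_⟩
    have := crossIntersecting_iff.1 (h.cross.inter_union (h.cross.swapFamily u v))
    exact this a hmem c hc
  have hle := h.weight_le {a} (by simpa using h.subset_left ha)
    {b ∈ multiPart n s | ¬ Disjoint a b} (filter_subset _ _) (by simp)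
    ⟨b, by simp [hb, hab]⟩ (by rw [crossIntersecting_iff]; simp +contextual)
  rw [← hw] at hle
  have hX : 0 < #(multiPart n t) := card_pos.2 ⟨a, h.subset_left ha⟩
  simp only [pairWeight] at hle
  have hle' := Nat.le_of_mul_le_mul_left (Nat.le_of_add_le_add_left hle) hX
  have heq := eq_of_subset_of_card_le hsub hle'
  have : b ∈ B ∪ swapFamily u v B := by rw [heq]; simp [hb, hab]
  rwa [mem_union, mem_swapFamily] at this

end IsMinimalOptimal

/-! ### Inequalities between binomial coefficients -/

theorem le_choose {m t : ℕ} (ht : 1 ≤ t) (htm : t + 1 ≤ m) : m ≤ m.choose t := by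
  induction m generalizing t with
  | zero => omega
  | succ m ih =>
    obtain ⟨t, rfl⟩ : ∃ k, t = k + 1 := ⟨t - 1, by omega⟩
    rw [Nat.choose_succ_succ']
    rcases Nat.lt_or_ge (t + 1) m with h | h
    · have := ih (t := t + 1) (by omega) (by omega)
      have := Nat.choose_pos (n := m) (k := t) (by omega)
      omega
    · obtain rfl : m = t + 1 := by omega
      simp

theorem mul_pred_le_two_mul_choose {m t : ℕ} (ht : 2 ≤ t) (htm : t + 2 ≤ m) :
    m * (m - 1) ≤ 2 * m.choose t := by
  induction m generalizing t with
  | zero => omega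
  | succ m ih =>
    have h2 : ∀ k, 2 * k.choose 2 = k * (k - 1) := fun k => by
      rw [Nat.choose_two_right, Nat.mul_div_cancel' (Nat.even_mul_pred_self k).two_dvd]
    rcases Nat.lt_or_ge (t + 2) (m + 1) with h | h
    · rcases Nat.lt_or_ge 2 t with h' | h'
      · obtain ⟨t, rfl⟩ : ∃ k, t = k + 1 := ⟨t - 1, by omega⟩
        rw [Nat.choose_succ_succ]
        have e1 := ih (t := t + 1) (by omega) (by omega)
        have e2 := ih (t := t) (by omega) (by omega)
        obtain ⟨m, rfl⟩ : ∃ k, m = k + 3 := ⟨m - 3, by omega⟩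
        simp only [Nat.add_succ_sub_one] at e1 e2 ⊢
        nlinarith
      · obtain rfl : t = 2 := by omega
        rw [h2]
    · obtain rfl : m = t + 1 := by omega
      have : (t + 1 + 1).choose t = (t + 2).choose 2 := by
        rw [← Nat.choose_symm (n := t + 2) (k := 2) (by omega)]; rfl
      rw [this, h2]

theorem sq_lt_three_mul_choose {n s t : ℕ} (hs : 2 ≤ s) (ht : 2 ≤ t) (hn : s + t + 1 ≤ n)
    (hs' : 2 * s ≤ n) (ht' : 2 * t ≤ n) : (n - t) ^ 2 < 3 * (s * (n - s).choose t) := by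
  obtain ⟨k, rfl⟩ : ∃ k, n = s + t + k := ⟨n - s - t, by omega⟩
  rw [show s + t + k - t = s + k by omega, show s + t + k - s = t + k by omega]
  rcases Nat.lt_or_ge k 2 with hk | hk
  · obtain rfl : k = 1 := by omega
    have := le_choose (m := t + 1) (t := t) (by omega) le_rfl
    have h2 : s * s ≤ s * (t + 1).choose t := Nat.mul_le_mul_left _ (by omega)
    nlinarith
  · have := mul_pred_le_two_mul_choose ht (show t + 2 ≤ t + k by omega)
    obtain ⟨m, hm⟩ : ∃ m, t + k = m + 1 := ⟨t + k - 1, by omega⟩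
    rw [hm] at this ⊢
    simp only [Nat.add_succ_sub_one] at this
    have h1 : s * ((m + 1) * m) ≤ s * (2 * (m + 1).choose t) := Nat.mul_le_mul_left _ this
    have h2 : s * s ≤ s * (m + 1) := Nat.mul_le_mul_left _ (by omega)
    have h3 : s * (k + 1) ≤ s * m := Nat.mul_le_mul_left _ (by omega)
    have h4 : k * k ≤ m * (m + 1) := Nat.mul_le_mul (by omega) (by omega)
    have h5 : 2 * (m * (m + 1)) ≤ s * (m * (m + 1)) := Nat.mul_le_mul_right _ hs
    have h6 : 3 * (s * (m + 1)) ≤ m * (s * (m + 1)) := Nat.mul_le_mul_right _ (by omega)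
    nlinarith

/-- The ratio `(n - s).choose t / n.choose t` is largest for `s = t = 2`, where it equals
`(n - 2) (n - 3) / (n (n - 1))`, which is at most `1 - 7 / (2 n)` since `5 ≤ n`. -/
theorem mul_choose_sub_le {n s t D : ℕ} (hs : 2 ≤ s) (ht : 2 ≤ t) (hn : s + t + 1 ≤ n)
    (hD : 2 * n ≤ 7 * D) : D * (n - s).choose t ≤ (D - 1) * n.choose t := by
  have h1 : (n - s).choose t ≤ (n - 2).choose t := Nat.choose_le_choose _ (by omega)
  have h2 := choose_mul_choose_swap (n := n) (s := 2) (t := t) (by omega)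
  have h3 : (n - t).choose 2 ≤ (n - 2).choose 2 := Nat.choose_le_choose _ (by omega)
  have h4 : n.choose 2 * (n - 2).choose t ≤ n.choose t * (n - 2).choose 2 :=
    h2.symm.le.trans (Nat.mul_le_mul_left _ h3)
  have h5 : D * (n - 2).choose 2 ≤ (D - 1) * n.choose 2 := by
    have e : ∀ k, 2 * k.choose 2 = k * (k - 1) := fun k => by
      rw [Nat.choose_two_right, Nat.mul_div_cancel' (Nat.even_mul_pred_self k).two_dvd]
    obtain ⟨m, rfl⟩ : ∃ m, n = m + 5 := ⟨n - 5, by omega⟩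
    obtain ⟨E, rfl⟩ : ∃ E, D = E + 1 := ⟨D - 1, by omega⟩
    have e1 := e (m + 5)
    have e2 := e (m + 5 - 2)
    rw [show m + 5 - 2 = m + 3 by omega] at e2 ⊢
    simp only [Nat.add_succ_sub_one] at e1 e2 ⊢
    nlinarith
  have hpos : 0 < n.choose 2 := Nat.choose_pos (by omega)
  refine Nat.le_of_mul_le_mul_left (?_ : n.choose 2 * _ ≤ n.choose 2 * _) hpos
  calc n.choose 2 * (D * (n - s).choose t) ≤ n.choose 2 * (D * (n - 2).choose t) := by gcongr
    _ = D * (n.choose 2 * (n - 2).choose t) := by ring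
    _ ≤ D * (n.choose t * (n - 2).choose 2) := by gcongr
    _ = n.choose t * (D * (n - 2).choose 2) := by ring
    _ ≤ n.choose t * ((D - 1) * n.choose 2) := by gcongr
    _ = _ := by ring

/-! ### Optimal pairs invariant under the swaps fixing a member -/

/-- Membership in a family that is stable under all swaps inside the parts in `I` does not depend
on the trace on these parts. -/
theorem mem_of_eq_outside {p : ℕ} {n t : Fin p → ℕ}
    {A : Finset (Finset (Σ i : Fin p, Fin (n i)))} (hA : A ⊆ multiPart n t)
    {I : Finset (Fin p)}
    (hI : ∀ u v : Σ i : Fin p, Fin (n i), u.1 = v.1 → u.1 ∈ I → swapFamily u v A = A)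
    {a c : Finset (Σ i : Fin p, Fin (n i))} (ha : a ∈ A) (hc : c ∈ multiPart n t)
    (hac : ∀ x, x.1 ∉ I → (x ∈ a ↔ x ∈ c)) : c ∈ A := by
  induction hk : #(a \ c) using Nat.strong_induction_on generalizing a with
  | _ k ih =>
    by_cases h0 : a ⊆ c
    · have : a = c := by
        refine eq_of_subset_of_card_le h0 ?_
        rw [card_eq_of_mem_multiPart hc, card_eq_of_mem_multiPart (hA ha)]
      exact this ▸ ha
    · obtain ⟨u, hua, huc⟩ := not_subset.1 h0
      have huI : u.1 ∈ I := by
        by_contra h; exact huc ((hac u h).1 hua)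
      have hcard : #{x ∈ a | x.1 = u.1} = #{x ∈ c | x.1 = u.1} := by
        rw [mem_multiPart.1 (hA ha), mem_multiPart.1 hc]
      obtain ⟨v, hvc, hva⟩ : ∃ v ∈ ({x ∈ c | x.1 = u.1} : Finset _),
          v ∉ ({x ∈ a | x.1 = u.1} : Finset _) := by
        rw [← not_subset]
        intro hsub
        have := eq_of_subset_of_card_le hsub hcard.le
        have hu : u ∈ ({x ∈ c | x.1 = u.1} : Finset _) := by rw [this]; simp [hua]
        exact huc (mem_filter.1 hu).1
      simp only [mem_filter, not_and'] at hvc hva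
      have hva := hva hvc.2
      have hmem : swapSet u v a ∈ A := by
        rw [← mem_swapFamily, hI u v hvc.2.symm huI]; exact ha
      refine ih _ ?_ hmem ?_ rfl
      · rw [← hk]
        refine card_lt_card ?_
        rw [ssubset_iff_of_subset]
        · refine ⟨u, by simp [hua, huc], ?_⟩
          simp [mem_swapSet, hva]
        · intro x hx
          rw [mem_sdiff, mem_swapSet, Equiv.swap_apply_def] at hx
          rw [mem_sdiff]
          refine ⟨?_, hx.2⟩
          have := hx.1
          split_ifs at this with e1 e2
          · rw [e1]; exact hua
          · exact absurd hvc.1 (e2 ▸ hx.2)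
          · exact this
      · intro x hx
        rw [← hac x hx, mem_swapSet, Equiv.swap_apply_of_ne_of_ne]
        · rintro rfl; exact hx huI
        · rintro rfl; exact hx (hvc.2 ▸ huI)

/-- Two members of a family which is invariant under all swaps that fix one of its members agree or
are complementary on every part whose swaps do not all preserve the family. -/
theorem IsMinimalOptimal.eq_or_compl {p : ℕ} {n t s : Fin p → ℕ}
    {A B : Finset (Finset (Σ i : Fin p, Fin (n i)))} (h : IsMinimalOptimal n t s A B)
    (hinv : ∀ c ∈ A, ∀ u v : Σ i : Fin p, Fin (n i), u.1 = v.1 → (u ∈ c ↔ v ∈ c) →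
      swapFamily u v A = A) {i : Fin p}
    (hi : ¬ ∀ u v : Σ i : Fin p, Fin (n i), u.1 = v.1 → u.1 = i → swapFamily u v A = A)
    {a c : Finset (Σ i : Fin p, Fin (n i))} (ha : a ∈ A) (hc : c ∈ A) :
    (∀ x, x.1 = i → (x ∈ a ↔ x ∈ c)) ∨ ∀ x, x.1 = i → (x ∈ a ↔ x ∉ c) := by
  -- One exchange inside the `i`-th part generates all swaps of this part.
  have key : ∀ e ∈ A, ∀ u v : Σ i : Fin p, Fin (n i), u.1 = i → v.1 = i → u ∈ e → v ∉ e →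
      swapSet u v e ∈ A → False := by
    intro e he u v hu hv hue hve hmem
    apply hi
    have hexch : ∀ u' v' : Σ i : Fin p, Fin (n i), u'.1 = i → v'.1 = i → u' ∈ e → v' ∉ e →
        swapSet u' v' e ∈ A := by
      intro u' v' hu' hv' hue' hve'
      have h1 : swapSet v v' (swapSet u u' (swapSet u v e)) ∈ A := by
        rw [← mem_swapFamily, hinv e he v v' (hv.trans hv'.symm) (by simp [hve, hve']),
          ← mem_swapFamily, hinv e he u u' (hu.trans hu'.symm) (by simp [hue, hue'])]
        exact hmem
      convert h1 using 1
      ext x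
      simp only [mem_swapSet, Equiv.swap_apply_def]
      split_ifs <;> grind
    have hall : ∀ u' v' : Σ i : Fin p, Fin (n i), u'.1 = i → v'.1 = i → u' ∈ e → v' ∉ e →
        swapFamily u' v' A = A := by
      intro u' v' hu' hv' hue' hve'
      have hm := hexch u' v' hu' hv' hue' hve'
      refine h.swapFamily_eq_self_of_mem (hu'.trans hv'.symm) (a := e) (b := swapSet u' v' e) ?_
        he hm hm (by rwa [swapSet_swapSet])
      intro hcon
      have := mem_iff_of_swapSet_eq_self hcon.symm
      exact hve' (this.1 hue')
    intro u' v' huv' hu'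
    have hv' : v'.1 = i := huv' ▸ hu'
    by_cases h1 : u' ∈ e <;> by_cases h2 : v' ∈ e
    · exact hinv e he u' v' huv' (by simp [h1, h2])
    · exact hall u' v' hu' hv' h1 h2
    · have := hall v' u' hv' hu' h2 h1
      rwa [swapFamily_comm] at this
    · exact hinv e he u' v' huv' (by simp [h1, h2])
  -- A swap that fixes `a` and moves `c` would yield such an exchange in `c`.
  have key2 : ∀ e ∈ A, ∀ f ∈ A, ∀ x y : Σ i : Fin p, Fin (n i), x.1 = i → y.1 = i →
      (x ∈ e ↔ y ∈ e) → ¬ (x ∈ f ↔ y ∈ f) → False := by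
    intro e he f hf x y hx hy hxy hxy'
    have hm : ∀ x y : Σ i : Fin p, Fin (n i), x.1 = i → y.1 = i → (x ∈ e ↔ y ∈ e) →
        swapSet x y f ∈ A := by
      intro x y hx hy hxy
      rw [← mem_swapFamily, hinv e he x y (hx.trans hy.symm) hxy]
      exact hf
    by_cases h1 : x ∈ f
    · exact key f hf x y hx hy h1 (by tauto) (hm x y hx hy hxy)
    · exact key f hf y x hy hx (by tauto) h1 (hm y x hy hx hxy.symm)
  by_contra hcon
  push Not at hcon
  obtain ⟨⟨x, hx, hx'⟩, ⟨y, hy, hy'⟩⟩ := hcon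
  by_cases hxy : x ∈ c ↔ y ∈ c
  · exact key2 c hc a ha x y hx hy hxy (by tauto)
  · exact key2 a ha c hc x y hx hy (by tauto) hxy

/-- The numerical fact behind `IsMinimalOptimal.weight_add_le_of_invariant`. It compares one part in
`I` with one part outside `I`, which is where the bounded ratio of the sizes of the parts is used. -/
theorem prod_choose_mul_pred_ge {p : ℕ} {n s t : Fin p → ℕ} (hnst : ∀ i, s i + t i + 1 ≤ n i)
    (hs2 : ∀ i, 2 ≤ s i) (ht2 : ∀ i, 2 ≤ t i) (hs : ∀ i, 2 * s i ≤ n i)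
    (hn : ∀ i j, i ≠ j → 4 * n i ≤ 7 * n j) {I : Finset (Fin p)} (hI : I ≠ univ) {m : ℕ}
    (hm2 : 2 ≤ m) (hm : ∏ i, (if i ∈ I then (n i).choose (t i) else 1) ≤ m) :
    ∏ i, (n i - s i).choose (t i) ≤
      m * (∏ i, (if i ∈ I then 1 else (n i - s i).choose (t i)) - 1) := by
  obtain ⟨j, hj⟩ : ∃ j, j ∉ I := by
    by_contra hcon; push Not at hcon; exact hI (eq_univ_of_forall hcon)
  set D := ∏ i, (if i ∈ I then 1 else (n i - s i).choose (t i)) with hDdef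
  have hpos : ∀ i, 1 ≤ (n i - s i).choose (t i) := fun i =>
    Nat.choose_pos (by have := hnst i; omega)
  have hD : n j - s j ≤ D := by
    refine (le_choose (t := t j) (by linarith [ht2 j]) (by have := hnst j; omega)).trans ?_
    have := Finset.single_le_prod' (f := fun i => if i ∈ I then 1 else (n i - s i).choose (t i))
      (s := univ) (fun i _ => by split_ifs; exacts [le_rfl, hpos i]) (mem_univ j)
    simpa [hj] using this
  have hsplit : ∏ i, (n i - s i).choose (t i) =
      (∏ i, (if i ∈ I then (n i - s i).choose (t i) else 1)) * D := by
    rw [hDdef, ← prod_mul_distrib]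
    exact prod_congr rfl fun i _ => by split_ifs <;> simp
  rw [hsplit]
  rcases I.eq_empty_or_nonempty with rfl | ⟨i, hi⟩
  · simp only [notMem_empty, if_false, prod_const_one, one_mul]
    have : 2 ≤ D := by have := hnst j; have := ht2 j; omega
    obtain ⟨E, hE⟩ : ∃ E, D = E + 1 := ⟨D - 1, by omega⟩
    rw [hE, Nat.add_sub_cancel]
    nlinarith
  · refine le_trans ?_ (Nat.mul_le_mul_right _ hm)
    have hij : i ≠ j := fun e => hj (e ▸ hi)
    have key := mul_choose_sub_le (hs2 i) (ht2 i) (hnst i) (D := D) (by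
      have := hn i j hij; have := hs j; omega)
    rw [← mul_prod_erase univ _ (mem_univ i), ← mul_prod_erase univ _ (mem_univ i)]
    simp only [hi, if_true]
    have hrest : ∏ x ∈ univ.erase i, (if x ∈ I then (n x - s x).choose (t x) else 1) ≤
        ∏ x ∈ univ.erase i, (if x ∈ I then (n x).choose (t x) else 1) := by
      refine prod_le_prod' fun x _ => ?_
      split_ifs
      · exact Nat.choose_le_choose _ (Nat.sub_le _ _)
      · exact le_rfl
    calc _ = D * (n i - s i).choose (t i) *
          ∏ x ∈ univ.erase i, (if x ∈ I then (n x - s x).choose (t x) else 1) := by ring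
      _ ≤ (D - 1) * (n i).choose (t i) *
          ∏ x ∈ univ.erase i, (if x ∈ I then (n x).choose (t x) else 1) :=
        Nat.mul_le_mul key hrest
      _ = _ := by ring

/-- The sets disjoint from some member of `A` are missing from `B`. -/
theorem CrossIntersecting.card_add_card_le {p : ℕ} {n s : Fin p → ℕ}
    {A B : Finset (Finset (Σ i : Fin p, Fin (n i)))} (h : CrossIntersecting A B)
    (hB : B ⊆ multiPart n s) :
    #B + #{b ∈ multiPart n s | ∃ a ∈ A, Disjoint a b} ≤ #(multiPart n s) := by
  rw [← card_union_of_disjoint]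
  · exact card_le_card (union_subset hB (filter_subset _ _))
  · rw [disjoint_left]
    intro b hb hb'
    obtain ⟨a, ha, hab⟩ := (mem_filter.1 hb').2
    exact crossIntersecting_iff.1 h a ha b hb hab

/-- If every swap fixing a member of `A` preserves `A`, then `A` is, up to complements inside
parts, the set of all members with a prescribed trace outside a set `I` of parts. Counting the
pairs `(a, b)` which are disjoint outside `I` bounds from below the number of members of
`multiPart n s` disjoint from some member of `A`. -/
theorem IsMinimalOptimal.weight_add_le_of_invariant {p : ℕ} {n t s : Fin p → ℕ}
    (hnst : ∀ i, s i + t i + 1 ≤ n i)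
    (hs2 : ∀ i, 2 ≤ s i) (ht2 : ∀ i, 2 ≤ t i) (hs : ∀ i, 2 * s i ≤ n i)
    (hn : ∀ i j, i ≠ j → 4 * n i ≤ 7 * n j)
    {A B : Finset (Finset (Σ i : Fin p, Fin (n i)))} (h : IsMinimalOptimal n t s A B)
    (hinv : ∀ c ∈ A, ∀ u v : Σ i : Fin p, Fin (n i), u.1 = v.1 → (u ∈ c ↔ v ∈ c) →
      swapFamily u v A = A) :
    pairWeight (multiPart n t) (multiPart n s) A B +
      #(multiPart n t) * ∏ i, (n i - t i).choose (s i) ≤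
      #(multiPart n t) * #(multiPart n s) := by
  classical
  set I : Finset (Fin p) := {i | ∀ u v : Σ i : Fin p, Fin (n i), u.1 = v.1 → u.1 = i →
    swapFamily u v A = A} with hIdef
  have hI : ∀ u v : Σ i : Fin p, Fin (n i), u.1 = v.1 → u.1 ∈ I → swapFamily u v A = A :=
    fun u v huv hu => (mem_filter.1 hu).2 u v huv rfl
  have hI' : ∀ i ∉ I, ∀ a ∈ A, ∀ c ∈ A,
      (∀ x, x.1 = i → (x ∈ a ↔ x ∈ c)) ∨ ∀ x, x.1 = i → (x ∈ a ↔ x ∉ c) :=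
    fun i hi a ha c hc => h.eq_or_compl hinv (fun hcon => hi (by simp [hIdef]; simpa using hcon))
      ha hc
  have hcardX : ∀ a ∈ A, ∀ i, #{x ∈ a | x.1 = i} = t i := fun a ha =>
    mem_multiPart.1 (h.subset_left ha)
  -- The members of `multiPart n t` disjoint from `Z a` are those with the same trace as `a`
  -- outside `I`.
  obtain ⟨Z, hZ⟩ : ∃ Z : Finset (Σ i : Fin p, Fin (n i)) → Finset (Σ i : Fin p, Fin (n i)),
      ∀ a x, x ∈ Z a ↔ x.1 ∉ I ∧ x ∉ a := ⟨fun a => {x | x.1 ∉ I ∧ x ∉ a}, by simp⟩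
  have htrace : ∀ a ∈ A, ∀ i, #{x ∈ Z a | x.1 = i} = if i ∈ I then 0 else n i - t i := by
    intro a ha i
    split_ifs with hi
    · rw [card_eq_zero, filter_eq_empty_iff]
      rintro x hx rfl
      simp [hi, hZ] at hx
    · have := hcardX a ha i
      rw [card_filter_fst_eq] at this ⊢
      have e := card_compl ({y : Fin (n i) | (⟨i, y⟩ : Σ i, Fin (n i)) ∈ a} : Finset _)
      rw [Fintype.card_fin, this, compl_filter] at e
      rw [← e]
      congr 1
      ext y
      simp [hi, hZ]
  have hcount : ∀ a ∈ A, #{c ∈ multiPart n t | Disjoint c (Z a)} =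
      ∏ i, (if i ∈ I then (n i).choose (t i) else 1) := by
    intro a ha
    rw [card_filter_disjoint]
    refine prod_congr rfl fun i _ => ?_
    rw [htrace a ha]
    split_ifs
    · simp
    · rw [Nat.sub_sub_self (by have := hnst i; omega), Nat.choose_self]
  have hmem_of_trace : ∀ a ∈ multiPart n t, ∀ c ∈ multiPart n t,
      Disjoint c (Z a) → ∀ x, x.1 ∉ I → (x ∈ c ↔ x ∈ a) := by
    intro a ha c hc hd x hx
    have hsub : ({y ∈ c | y.1 = x.1} : Finset _) ⊆ {y ∈ a | y.1 = x.1} := by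
      intro y hy
      rw [mem_filter] at hy ⊢
      refine ⟨?_, hy.2⟩
      by_contra hya
      exact disjoint_left.1 hd hy.1 ((hZ ..).2 ⟨hy.2 ▸ hx, hya⟩)
    have heq := eq_of_subset_of_card_le hsub
      (by rw [mem_multiPart.1 ha, mem_multiPart.1 hc])
    have : x ∈ ({y ∈ c | y.1 = x.1} : Finset _) ↔ x ∈ ({y ∈ a | y.1 = x.1} : Finset _) := by
      rw [heq]
    simpa using this
  obtain ⟨a₀, ha₀⟩ : A.Nonempty := card_pos.1 (by have := h.two_le_left; omega)
  obtain ⟨b₀, hb₀⟩ : B.Nonempty := card_pos.1 (by have := h.two_le_right; omega)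
  have hAge : ∏ i, (if i ∈ I then (n i).choose (t i) else 1) ≤ #A := by
    rw [← hcount a₀ ha₀]
    refine card_le_card fun c hc => ?_
    rw [mem_filter] at hc
    exact mem_of_eq_outside h.subset_left hI ha₀ hc.1 fun x hx =>
      (hmem_of_trace a₀ (h.subset_left ha₀) c hc.1 hc.2 x hx).symm
  set N : Finset (Finset (Σ i : Fin p, Fin (n i))) :=
    {b ∈ multiPart n s | ∃ a ∈ A, Disjoint a b} with hNdef
  -- Disjointness outside `I` suffices for a set to be disjoint from a member of `A`.
  have hN : ∀ a ∈ A, ∀ b ∈ multiPart n s, Disjoint b {x ∈ a | x.1 ∉ I} → b ∈ N := by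
    intro a ha b hb hd
    have hex : 0 < #{c ∈ multiPart n t | Disjoint c
        ({x | (x.1 ∈ I ∧ x ∈ b) ∨ (x.1 ∉ I ∧ x ∉ a)} : Finset (Σ i : Fin p, Fin (n i)))} := by
      rw [card_filter_disjoint]
      refine prod_pos fun i _ => Nat.choose_pos ?_
      by_cases hi : i ∈ I
      · have : #{x ∈ ({x | (x.1 ∈ I ∧ x ∈ b) ∨ (x.1 ∉ I ∧ x ∉ a)} :
            Finset (Σ i : Fin p, Fin (n i))) | x.1 = i} = s i := by
          rw [← mem_multiPart.1 hb i]
          congr 1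
          ext x
          simp only [mem_filter, mem_univ, true_and]
          constructor
          · rintro ⟨h1, rfl⟩; simpa [hi] using h1
          · rintro ⟨h1, rfl⟩; simpa [hi] using h1
        rw [this]
        have := hnst i
        omega
      · have : #{x ∈ ({x | (x.1 ∈ I ∧ x ∈ b) ∨ (x.1 ∉ I ∧ x ∉ a)} :
            Finset (Σ i : Fin p, Fin (n i))) | x.1 = i} = n i - t i := by
          have h1 := htrace a ha i
          rw [if_neg hi] at h1
          rw [← h1]
          congr 1
          ext x
          simp only [mem_filter, mem_univ, true_and, hZ]
          constructor
          · rintro ⟨h2, rfl⟩; simpa [hi] using h2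
          · rintro ⟨h2, rfl⟩; simpa [hi] using h2
        rw [this]
        have := hnst i
        omega
    obtain ⟨c, hc⟩ := card_pos.1 hex
    rw [mem_filter, disjoint_left] at hc
    have hca := hmem_of_trace a (h.subset_left ha) c hc.1 (by
      rw [disjoint_left]
      intro x hx hx'
      refine hc.2 hx ?_
      simp only [mem_filter, mem_univ, true_and]
      exact Or.inr ((hZ ..).1 hx'))
    have hcA : c ∈ A := mem_of_eq_outside h.subset_left hI ha hc.1 fun x hx => (hca x hx).symm
    rw [hNdef, mem_filter]
    refine ⟨hb, c, hcA, ?_⟩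
    rw [disjoint_left]
    intro x hxc hxb
    by_cases hx : x.1 ∈ I
    · exact hc.2 hxc (by simp [hx, hxb])
    · exact disjoint_left.1 hd hxb (by simp [hx, (hca x hx).1 hxc])
  have hIuniv : I ≠ univ := by
    intro hIu
    have : b₀ ∈ N := hN a₀ ha₀ b₀ (h.subset_right hb₀) (by simp [hIu])
    obtain ⟨a, ha, hab⟩ := (mem_filter.1 this).2
    exact crossIntersecting_iff.1 h.cross a ha b₀ hb₀ hab
  -- Double counting of the pairs which are disjoint outside `I`.
  have hdc : #A * ∏ i, (n i - if i ∈ I then 0 else t i).choose (s i) ≤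
      #N * ∏ i, (if i ∈ I then (n i).choose (t i) else 1) := by
    refine card_mul_le_card_mul (fun a b => Disjoint b (a.filter fun x => x.1 ∉ I)) ?_ ?_
    · intro a ha
      have : ∏ i, (n i - if i ∈ I then 0 else t i).choose (s i) =
          #{b ∈ multiPart n s | Disjoint b {x ∈ a | x.1 ∉ I}} := by
        rw [card_filter_disjoint]
        refine prod_congr rfl fun i _ => ?_
        congr 2
        split_ifs with hi
        · symm
          rw [card_eq_zero, filter_eq_empty_iff]
          rintro x hx rfl
          simp [hi] at hx
        · rw [← hcardX a ha i]
          congr 1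
          ext x
          simp only [mem_filter]
          constructor
          · rintro ⟨h1, rfl⟩; exact ⟨⟨h1, hi⟩, rfl⟩
          · rintro ⟨h1, rfl⟩; exact ⟨h1.1, rfl⟩
      rw [this]
      refine card_le_card fun b hb => ?_
      rw [mem_filter] at hb
      rw [mem_bipartiteAbove]
      exact ⟨hN a ha b hb.1 hb.2, hb.2⟩
    · intro b hb
      rcases (A.bipartiteBelow (fun a b => Disjoint b (a.filter fun x => x.1 ∉ I)) b).eq_empty_or_nonempty
        with he | ⟨a, hab⟩
      · rw [he]; simp
      rw [mem_bipartiteBelow] at hab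
      rw [← hcount a hab.1]
      refine card_le_card fun c hcb => ?_
      rw [mem_bipartiteBelow] at hcb
      rw [mem_filter]
      refine ⟨h.subset_left hcb.1, ?_⟩
      rw [disjoint_left]
      intro x hxc hx
      rw [hZ] at hx
      rcases hI' x.1 hx.1 a hab.1 c hcb.1 with h1 | h1
      · exact hx.2 ((h1 x rfl).2 hxc)
      -- A set disjoint from two complementary traces would be empty on this part.
      · have hbn : 0 < #{y ∈ b | y.1 = x.1} := by
          rw [mem_multiPart.1 (mem_filter.1 hb).1]
          linarith [hs2 x.1]
        obtain ⟨y, hy⟩ := card_pos.1 hbn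
        rw [mem_filter] at hy
        have hyI : y.1 ∉ I := hy.2 ▸ hx.1
        have hya : y ∉ a := fun hya => disjoint_left.1 hab.2 hy.1 (by simp [hya, hyI])
        have hyc : y ∉ c := fun hyc => disjoint_left.1 hcb.2 hy.1 (by simp [hyc, hyI])
        exact hya ((h1 y hy.2).2 hyc)
  set D := ∏ i, (if i ∈ I then 1 else (n i - s i).choose (t i)) with hD
  have hmain : #A * (#(multiPart n s) * D) ≤ #N * #(multiPart n t) := by
    have e1 : #(multiPart n s) * D = (∏ i, (n i - if i ∈ I then 0 else t i).choose (s i)) *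
        ∏ i, (if i ∈ I then 1 else (n i).choose (t i)) := by
      rw [card_multiPart, hD, ← prod_mul_distrib, ← prod_mul_distrib]
      refine prod_congr rfl fun i _ => ?_
      split_ifs
      · simp
      · rw [← choose_mul_choose_swap (by have := hnst i; omega), mul_comm]
    have e2 : #(multiPart n t) = (∏ i, (if i ∈ I then (n i).choose (t i) else 1)) *
        ∏ i, (if i ∈ I then 1 else (n i).choose (t i)) := by
      rw [card_multiPart, ← prod_mul_distrib]
      refine prod_congr rfl fun i _ => ?_
      split_ifs <;> simp
    rw [e1, e2, ← mul_assoc, ← mul_assoc]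
    exact Nat.mul_le_mul_right _ hdc
  have hnum := prod_choose_mul_pred_ge hnst hs2 ht2 hs hn hIuniv h.two_le_left hAge
  rw [← hD] at hnum
  have hDpos : 1 ≤ D := by
    refine Finset.one_le_prod' fun i _ => ?_
    split_ifs
    · exact le_rfl
    · exact Nat.choose_pos (by have := hnst i; omega)
  have hBN := h.cross.card_add_card_le h.subset_right
  rw [← hNdef] at hBN
  rw [card_mul_card_filter_disjoint hnst, pairWeight]
  obtain ⟨E, hE⟩ : ∃ E, D = E + 1 := ⟨D - 1, by omega⟩
  rw [hE] at hmain hnum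
  rw [Nat.add_sub_cancel] at hnum
  have e1 := Nat.mul_le_mul_left #(multiPart n s) hnum
  have e2 := Nat.mul_le_mul_left #(multiPart n t) hBN
  nlinarith

/-! ### Optimal pairs moved by a swap fixing a member -/

theorem exists_mem_multiPart_disjoint {p : ℕ} {n s : Fin p → ℕ}
    {Z : Finset (Σ i : Fin p, Fin (n i))} (hZ : ∀ i, #{x ∈ Z | x.1 = i} + s i ≤ n i)
    {x : Σ i : Fin p, Fin (n i)} (hx : x ∉ Z) (hs : 1 ≤ s x.1) :
    ∃ b ∈ multiPart n s, Disjoint b Z ∧ x ∈ b := by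
  have hpos : 0 < #{b ∈ multiPart n s | Disjoint b Z} := by
    rw [card_filter_disjoint]
    exact prod_pos fun i _ => Nat.choose_pos (by have := hZ i; omega)
  obtain ⟨b, hb⟩ := card_pos.1 hpos
  rw [mem_filter] at hb
  have hbx : 0 < #{y ∈ b | y.1 = x.1} := by rw [mem_multiPart.1 hb.1]; exact hs
  obtain ⟨y, hy⟩ := card_pos.1 hbx
  rw [mem_filter] at hy
  refine ⟨swapSet x y b, (swapSet_mem_multiPart hy.2.symm).2 hb.1, ?_, ?_⟩
  · rw [disjoint_left]
    intro z hz hzZ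
    rw [mem_swapSet, Equiv.swap_apply_def] at hz
    split_ifs at hz with e1 e2
    · exact hx (e1 ▸ hzZ)
    · exact disjoint_left.1 hb.2 hy.1 (e2 ▸ hzZ)
    · exact disjoint_left.1 hb.2 hz hzZ
  · rw [mem_swapSet, Equiv.swap_apply_left]
    exact hy.1

theorem exists_eq_insert_erase {p : ℕ} {n t : Fin p → ℕ} {a c : Finset (Σ i : Fin p, Fin (n i))}
    (ha : a ∈ multiPart n t) (hc : c ∈ multiPart n t) {v : Σ i : Fin p, Fin (n i)}
    (hva : v ∈ a) (hvc : v ∉ c) (hac : a ⊆ insert v c) :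
    ∃ w, w.1 = v.1 ∧ w ∉ a ∧ c = insert w (a.erase v) := by
  have hcard : #{x ∈ c | x.1 = v.1} = #{x ∈ a | x.1 = v.1} := by
    rw [mem_multiPart.1 ha, mem_multiPart.1 hc]
  obtain ⟨w, hw, hw'⟩ : ∃ w ∈ ({x ∈ c | x.1 = v.1} : Finset _),
      w ∉ ({x ∈ a | x.1 = v.1} : Finset _) := by
    rw [← not_subset]
    intro hsub
    have := eq_of_subset_of_card_le hsub hcard.ge
    have hv : v ∈ ({x ∈ c | x.1 = v.1} : Finset _) := by rw [this]; simp [hva]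
    exact hvc (mem_filter.1 hv).1
  rw [mem_filter] at hw hw'
  have hwa : w ∉ a := fun h => hw' ⟨h, hw.2⟩
  refine ⟨w, hw.2, hwa, (eq_of_subset_of_card_le ?_ ?_).symm⟩
  · intro x hx
    rcases mem_insert.1 hx with rfl | hx
    · exact hw.1
    · rw [mem_erase] at hx
      exact (mem_insert.1 (hac hx.2)).resolve_left hx.1
  · rw [card_insert_of_notMem (fun h => hwa (mem_of_mem_erase h)), card_erase_add_one hva,
      card_eq_of_mem_multiPart ha, card_eq_of_mem_multiPart hc]

namespace IsMinimalOptimal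

variable {p : ℕ} {n t s : Fin p → ℕ} {A B : Finset (Finset (Σ i : Fin p, Fin (n i)))}
  {u v : Σ i : Fin p, Fin (n i)}

/-- A swap of `u` and `v` that fixes `a ∈ A` but does not preserve `A` severely restricts the other
members `c` of `A`: every set meeting `a` meets `c` or its image, so `a ⊆ c ∪ {v}` if `v ∉ c`.
Here `s i + t i + 1 ≤ n i` leaves room for a set that avoids `c ∪ {v}`. -/
theorem subset_insert_of_mem (h : IsMinimalOptimal n t s A B)
    (hnst : ∀ i, s i + t i + 1 ≤ n i) (hs2 : ∀ i, 2 ≤ s i) (huv : u.1 = v.1)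
    {a c : Finset (Σ i : Fin p, Fin (n i))} (ha : a ∈ A) (hc : c ∈ A)
    (hfix : u ∈ a ↔ v ∈ a) (hne : swapFamily u v A ≠ A) (hvc : v ∉ c) :
    a ⊆ insert v c := by
  intro x hx
  by_contra hxc
  -- Otherwise some `b` through `x` misses `c` and its image under the swap.
  obtain ⟨b, hb, hbd, hxb⟩ := exists_mem_multiPart_disjoint (s := s) (Z := insert v c)
    (fun i => by
      have h1 := mem_multiPart.1 (h.subset_left hc) i
      have h2 := hnst i
      have h3 : #{x ∈ insert v c | x.1 = i} ≤ #{x ∈ c | x.1 = i} + 1 := by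
        rw [filter_insert]
        split_ifs
        · exact card_insert_le _ _
        · omega
      omega) hxc (by linarith [hs2 x.1])
  rw [disjoint_insert_right] at hbd
  have hcross := crossIntersecting_iff.1 h.cross
  rcases h.mem_or_mem_of_not_disjoint huv ha (swapSet_eq_self hfix) hne hb
    (not_disjoint_iff.2 ⟨x, hx, hxb⟩) with hbB | hbB
  · exact hcross c hc b hbB hbd.2.symm
  · refine hcross c hc _ hbB ?_
    rw [← disjoint_swapSet (u := u) (v := v), swapSet_swapSet, disjoint_left]
    intro y hy hyb
    rw [mem_swapSet, Equiv.swap_apply_def] at hy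
    split_ifs at hy with e1 e2
    · exact hvc hy
    · exact hbd.1 (e2 ▸ hyb)
    · exact disjoint_left.1 hbd.2 hyb hy

theorem exchange_of_mem (h : IsMinimalOptimal n t s A B)
    (hnst : ∀ i, s i + t i + 1 ≤ n i) (hs2 : ∀ i, 2 ≤ s i) (huv : u.1 = v.1)
    {a c : Finset (Σ i : Fin p, Fin (n i))} (ha : a ∈ A) (hc : c ∈ A) (hac : a ≠ c)
    (hfix : u ∈ a ↔ v ∈ a) (hne : swapFamily u v A ≠ A) (hvc : v ∉ c) :
    v ∈ a ∧ ∃ w, w.1 = v.1 ∧ w ∉ a ∧ c = insert w (a.erase v) := by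
  have hsub := h.subset_insert_of_mem hnst hs2 huv ha hc hfix hne hvc
  have hva : v ∈ a := by
    by_contra hva
    refine hac (eq_of_subset_of_card_le ((subset_insert_iff_of_notMem hva).1 hsub) ?_)
    rw [card_eq_of_mem_multiPart (h.subset_left ha), card_eq_of_mem_multiPart (h.subset_left hc)]
  exact ⟨hva, exists_eq_insert_erase (h.subset_left ha) (h.subset_left hc) hva hvc hsub⟩

theorem not_mem_iff_mem_and_mem_of_ne (h : IsMinimalOptimal n t s A B)
    (hnst : ∀ i, s i + t i + 1 ≤ n i) (hs2 : ∀ i, 2 ≤ s i) (huv : u.1 = v.1)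
    {a c : Finset (Σ i : Fin p, Fin (n i))} (ha : a ∈ A) (hc : c ∈ A) (hac : a ≠ c)
    (hfix : u ∈ a ↔ v ∈ a) (hne : swapFamily u v A ≠ A) :
    ¬ (u ∈ c ↔ v ∈ c) ∧ u ∈ a := by
  have h1 : ¬ (u ∈ c ↔ v ∈ c) := fun hfix' =>
    hne (h.swapFamily_eq_self_of_mem huv hac ha hc (by rwa [swapSet_eq_self hfix])
      (by rwa [swapSet_eq_self hfix']))
  refine ⟨h1, ?_⟩
  by_cases huc : u ∈ c
  · exact hfix.2 (h.exchange_of_mem hnst hs2 huv ha hc hac hfix hne (by tauto)).1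
  · exact (h.exchange_of_mem hnst hs2 huv.symm ha hc hac hfix.symm
      (by rwa [swapFamily_comm]) huc).1

/-- All members other than `a` arise from `a` by exchanging the same element `v`. -/
theorem eq_insert_erase_of_mem (h : IsMinimalOptimal n t s A B)
    (hnst : ∀ i, s i + t i + 1 ≤ n i) (hs2 : ∀ i, 2 ≤ s i) (huv : u.1 = v.1)
    {a c e : Finset (Σ i : Fin p, Fin (n i))} (ha : a ∈ A) (hc : c ∈ A) (hac : a ≠ c)
    (hfix : u ∈ a ↔ v ∈ a) (hne : swapFamily u v A ≠ A) (huc : u ∈ c) (hvc : v ∉ c)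
    (he : e ∈ A) (hae : a ≠ e) : ∃ w, w.1 = v.1 ∧ w ∉ a ∧ e = insert w (a.erase v) := by
  by_cases hue : u ∈ e
  · have hve : v ∉ e := by
      have := (h.not_mem_iff_mem_and_mem_of_ne hnst hs2 huv ha he hae hfix hne).1
      tauto
    exact (h.exchange_of_mem hnst hs2 huv ha he hae hfix hne hve).2
  · exfalso
    have hve : v ∈ e := by
      have := (h.not_mem_iff_mem_and_mem_of_ne hnst hs2 huv ha he hae hfix hne).1
      tauto
    obtain ⟨hva, w, hwv, hwa, rfl⟩ := h.exchange_of_mem hnst hs2 huv ha hc hac hfix hne hvc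
    obtain ⟨hua, z, hzu, hza, rfl⟩ := h.exchange_of_mem hnst hs2 huv.symm ha he hae hfix.symm
      (by rwa [swapFamily_comm]) hue
    -- The swap of `w` and `z` fixes `a` without meeting it, so it preserves `A`.
    have hzw : swapFamily z w A = A := by
      by_contra hne'
      exact hza (h.not_mem_iff_mem_and_mem_of_ne hnst hs2 (hzu.trans (huv.trans hwv.symm)) ha hc hac
        (by simp [hza, hwa]) hne').2
    refine hne (h.swapFamily_eq_self_of_mem huv hac ha hc (by rwa [swapSet_eq_self hfix]) ?_)
    have h1 : swapSet z w (insert z (a.erase u)) ∈ A := by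
      rw [← mem_swapFamily, hzw]; exact he
    convert h1 using 1
    ext x
    simp only [mem_swapSet, Equiv.swap_apply_def]
    have huv' : u ≠ v := by rintro rfl; exact hne (by
      ext x; simp [mem_swapFamily, swapSet_eq_self])
    split_ifs <;> grind

/-- A family moved by a swap that fixes one of its members has only linearly many members. -/
theorem card_le_of_not_invariant (h : IsMinimalOptimal n t s A B)
    (hnst : ∀ i, s i + t i + 1 ≤ n i) (hs2 : ∀ i, 2 ≤ s i) (huv : u.1 = v.1)
    {a c : Finset (Σ i : Fin p, Fin (n i))} (ha : a ∈ A) (hc : c ∈ A) (hac : a ≠ c)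
    (hfix : u ∈ a ↔ v ∈ a) (hne : swapFamily u v A ≠ A) (huc : u ∈ c) (hvc : v ∉ c) :
    #A ≤ (n v.1 - t v.1) + 1 := by
  have hsub : A ⊆ insert a
      (({w | w.1 = v.1 ∧ w ∉ a} : Finset _).image fun w => insert w (a.erase v)) := by
    intro e he
    rw [mem_insert]
    by_cases hae : a = e
    · exact Or.inl hae.symm
    · obtain ⟨w, hw, hwa, rfl⟩ :=
        h.eq_insert_erase_of_mem hnst hs2 huv ha hc hac hfix hne huc hvc he hae
      exact Or.inr (mem_image.2 ⟨w, by simp [hw, hwa], rfl⟩)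
  refine (card_le_card hsub).trans ((card_insert_le _ _).trans ?_)
  refine Nat.add_le_add_right (card_image_le.trans ?_) 1
  have h1 : #({w | w.1 = v.1 ∧ w ∉ a} : Finset (Σ i : Fin p, Fin (n i))) =
      #{w ∈ aᶜ | w.1 = v.1} := by
    congr 1; ext w; simp [and_comm]
  rw [h1, card_filter_fst_eq]
  have h2 := mem_multiPart.1 (h.subset_left ha) v.1
  rw [card_filter_fst_eq] at h2
  have h3 := card_compl ({y : Fin (n v.1) | (⟨v.1, y⟩ : Σ i, Fin (n i)) ∈ a} : Finset _)
  rw [Fintype.card_fin, h2, compl_filter] at h3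
  rw [← h3]
  simp

/-- Already the sets disjoint from `a` or from `c` are too many for `B` to make up for the few members
of `A`. -/
theorem weight_add_lt_of_exchange (h : IsMinimalOptimal n t s A B) (hp : 2 ≤ p)
    (hnst : ∀ i, s i + t i + 1 ≤ n i) (hs2 : ∀ i, 2 ≤ s i) (ht2 : ∀ i, 2 ≤ t i)
    (hs : ∀ i, 2 * s i ≤ n i) (ht : ∀ i, 2 * t i ≤ n i) (huv : u.1 = v.1)
    {a c : Finset (Σ i : Fin p, Fin (n i))} (ha : a ∈ A) (hc : c ∈ A) (hac : a ≠ c)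
    (hfix : u ∈ a ↔ v ∈ a) (hne : swapFamily u v A ≠ A) (huc : u ∈ c) (hvc : v ∉ c) :
    pairWeight (multiPart n t) (multiPart n s) A B +
      #(multiPart n t) * ∏ i, (n i - t i).choose (s i) <
      #(multiPart n t) * #(multiPart n s) + #(multiPart n s) := by
  have hA := h.card_le_of_not_invariant hnst hs2 huv ha hc hac hfix hne huc hvc
  obtain ⟨hva, w, hwv, hwa, hcw⟩ := h.exchange_of_mem hnst hs2 huv ha hc hac hfix hne hvc
  have hBN := h.cross.card_add_card_le h.subset_right
  have hunion : ({b ∈ multiPart n s | Disjoint b a} : Finset _) ∪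
      {b ∈ multiPart n s | Disjoint b c} ⊆ {b ∈ multiPart n s | ∃ a ∈ A, Disjoint a b} := by
    intro b hb
    simp only [mem_union, mem_filter] at hb ⊢
    rcases hb with hb | hb
    · exact ⟨hb.1, a, ha, hb.2.symm⟩
    · exact ⟨hb.1, c, hc, hb.2.symm⟩
  have hN := card_le_card hunion
  have hui := card_union_add_card_inter ({b ∈ multiPart n s | Disjoint b a} : Finset _)
    {b ∈ multiPart n s | Disjoint b c}
  have hinter : ({b ∈ multiPart n s | Disjoint b a} : Finset _) ∩
      {b ∈ multiPart n s | Disjoint b c} = {b ∈ multiPart n s | Disjoint b (insert w a)} := by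
    ext b
    simp only [mem_inter, mem_filter, hcw, disjoint_insert_right]
    constructor
    · rintro ⟨⟨h1, h2⟩, -, h3, -⟩; exact ⟨h1, h3, h2⟩
    · rintro ⟨h1, h2, h3⟩
      exact ⟨⟨h1, h3⟩, h1, h2, h3.mono_right (erase_subset _ _)⟩
  rw [hinter, card_filter_disjoint_of_mem (h.subset_left ha),
    card_filter_disjoint_of_mem (h.subset_left hc), card_filter_disjoint] at hui
  set D := ∏ i ∈ univ.erase v.1, (n i - t i).choose (s i) with hD
  have hd : ∏ i, (n i - t i).choose (s i) = (n v.1 - t v.1).choose (s v.1) * D :=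
    (mul_prod_erase univ _ (mem_univ v.1)).symm
  have hd' : ∏ i, (n i - #{x ∈ insert w a | x.1 = i}).choose (s i) =
      (n v.1 - t v.1 - 1).choose (s v.1) * D := by
    rw [← mul_prod_erase univ _ (mem_univ v.1), hD]
    congr 1
    · rw [filter_insert, if_pos hwv, card_insert_of_notMem (by simp [hwa]),
        mem_multiPart.1 (h.subset_left ha), Nat.sub_sub]
    · refine prod_congr rfl fun i hi => ?_
      rw [filter_insert, if_neg (by rw [hwv]; exact (ne_of_mem_erase hi).symm),
        mem_multiPart.1 (h.subset_left ha)]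
  have hdual := card_mul_card_filter_disjoint hnst
  -- The second factor of the product, which exists since `2 ≤ p`, is at least `3`.
  have hd3 : 3 * (n v.1 - s v.1).choose (t v.1) ≤ ∏ i, (n i - s i).choose (t i) := by
    have : Nontrivial (Fin p) := Fin.nontrivial_iff_two_le.2 hp
    obtain ⟨j, hj⟩ := exists_ne v.1
    rw [← mul_prod_erase univ _ (mem_univ v.1), mul_comm 3]
    refine Nat.mul_le_mul_left _ ?_
    have h1 := Finset.single_le_prod' (f := fun i => (n i - s i).choose (t i))
      (s := univ.erase v.1) (fun i _ => Nat.choose_pos (by have := hnst i; omega))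
      (mem_erase.2 ⟨hj, mem_univ j⟩)
    have h2 := le_choose (m := n j - s j) (t := t j) (by linarith [ht2 j])
      (by have := hnst j; omega)
    have h3 := hnst j
    have h4 := ht2 j
    omega
  have hsq := sq_lt_three_mul_choose (hs2 v.1) (ht2 v.1) (hnst v.1) (hs v.1) (ht v.1)
  have hX : 0 < #(multiPart n s) := by
    obtain ⟨b, hb⟩ : B.Nonempty := card_pos.1 (by have := h.two_le_right; omega)
    exact card_pos.2 ⟨b, h.subset_right hb⟩
  obtain ⟨m, hm⟩ : ∃ m, n v.1 - t v.1 = m + 1 :=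
    ⟨n v.1 - t v.1 - 1, by have := hnst v.1; omega⟩
  obtain ⟨r, hr⟩ : ∃ r, s v.1 = r + 1 := ⟨s v.1 - 1, by have := hs2 v.1; omega⟩
  have hpascal : (m + 1).choose (r + 1) = m.choose r + m.choose (r + 1) := Nat.choose_succ_succ ..
  have habs : (m + 1) * m.choose r = (m + 1).choose (r + 1) * (r + 1) :=
    Nat.add_one_mul_choose_eq m r
  rw [hd'] at hui
  rw [pairWeight]
  set d := ∏ i, (n i - t i).choose (s i) with hdd
  set d' := ∏ i, (n i - s i).choose (t i) with hdd'
  rw [hm] at hA hsq hui hd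
  rw [Nat.add_sub_cancel] at hui
  set X := #(multiPart n t)
  set Y := #(multiPart n s)
  -- The number of sets disjoint from `c` but not from `a` exceeds `(|A| - 1) |Y| / |X|`.
  have hkey : Y * (m + 1) < X * (m.choose r * D) := by
    refine Nat.lt_of_mul_lt_mul_left (a := m + 1) ?_
    have e1 : (m + 1) * (X * (m.choose r * D)) = s v.1 * (Y * d') := by
      rw [← hdual, hd, hr]
      calc _ = X * ((m + 1) * m.choose r) * D := by ring
        _ = _ := by rw [habs]; ring
    rw [e1]
    calc (m + 1) * (Y * (m + 1)) = Y * (m + 1) ^ 2 := by ring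
      _ < Y * (3 * (s v.1 * (n v.1 - s v.1).choose (t v.1))) := Nat.mul_lt_mul_of_pos_left hsq hX
      _ = s v.1 * (Y * (3 * (n v.1 - s v.1).choose (t v.1))) := by ring
      _ ≤ _ := by gcongr
  have hNd : #B + d + m.choose r * D ≤ Y := by
    have : d = m.choose r * D + m.choose (r + 1) * D := by
      rw [hd, hr, hpascal]; ring
    rw [hr] at hui
    omega
  have e1 := Nat.mul_le_mul_left X hNd
  have e2 := Nat.mul_le_mul_left Y hA
  nlinarith

theorem weight_add_lt (h : IsMinimalOptimal n t s A B) (hp : 2 ≤ p)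
    (hnst : ∀ i, s i + t i + 1 ≤ n i) (hs2 : ∀ i, 2 ≤ s i) (ht2 : ∀ i, 2 ≤ t i)
    (hs : ∀ i, 2 * s i ≤ n i) (ht : ∀ i, 2 * t i ≤ n i)
    (hn : ∀ i j, i ≠ j → 4 * n i ≤ 7 * n j) :
    pairWeight (multiPart n t) (multiPart n s) A B +
      #(multiPart n t) * ∏ i, (n i - t i).choose (s i) <
      #(multiPart n t) * #(multiPart n s) + #(multiPart n s) := by
  by_cases hinv : ∀ c ∈ A, ∀ u v : Σ i : Fin p, Fin (n i), u.1 = v.1 → (u ∈ c ↔ v ∈ c) →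
      swapFamily u v A = A
  · have hX : 0 < #(multiPart n s) := by
      obtain ⟨b, hb⟩ : B.Nonempty := card_pos.1 (by have := h.two_le_right; omega)
      exact card_pos.2 ⟨b, h.subset_right hb⟩
    have := h.weight_add_le_of_invariant hnst hs2 ht2 hs hn hinv
    omega
  · push Not at hinv
    obtain ⟨a, ha, u, v, huv, hfix, hne⟩ := hinv
    obtain ⟨c, hc, hca⟩ := exists_mem_ne (s := A) h.two_le_left a
    have h1 := (h.not_mem_iff_mem_and_mem_of_ne hnst hs2 huv ha hc hca.symm hfix hne).1
    by_cases huc : u ∈ c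
    · exact h.weight_add_lt_of_exchange hp hnst hs2 ht2 hs ht huv ha hc hca.symm hfix hne huc
        (by tauto)
    · exact h.weight_add_lt_of_exchange hp hnst hs2 ht2 hs ht huv.symm ha hc hca.symm hfix.symm
        (by rwa [swapFamily_comm]) (by tauto) huc

end IsMinimalOptimal

/-! ### The sharp bound -/

theorem CrossIntersecting.card_add_le_of_singleton {p : ℕ} {n s t : Fin p → ℕ}
    {B : Finset (Finset (Σ i : Fin p, Fin (n i)))} {a : Finset (Σ i : Fin p, Fin (n i))}
    (h : CrossIntersecting {a} B) (ha : a ∈ multiPart n t) (hB : B ⊆ multiPart n s) :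
    #B + ∏ i, (n i - t i).choose (s i) ≤ #(multiPart n s) := by
  have := h.card_add_card_le hB
  rw [← card_filter_disjoint_of_mem ha]
  simpa [disjoint_comm] using this

theorem card_filter_inter_nonempty_add {p : ℕ} {n s t : Fin p → ℕ}
    {a : Finset (Σ i : Fin p, Fin (n i))} (ha : a ∈ multiPart n t) :
    #{b ∈ multiPart n s | (b ∩ a).Nonempty} + ∏ i, (n i - t i).choose (s i) =
      #(multiPart n s) := by
  rw [← card_filter_disjoint_of_mem ha, add_comm,
    ← card_filter_add_card_filter_not (s := multiPart n s) (fun b => Disjoint b a)]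
  simp [not_disjoint_iff_nonempty_inter]

/-- A cross-intersecting pair of families with at least two members each weighs less than the
heaviest of the pairs consisting of one set and all sets that meet it. -/
theorem CrossIntersecting.pairWeight_add_lt {p : ℕ} (hp : 2 ≤ p) {n s t : Fin p → ℕ}
    (hnst : ∀ i, s i + t i + 1 ≤ n i) (hs2 : ∀ i, 2 ≤ s i) (ht2 : ∀ i, 2 ≤ t i)
    (hs : ∀ i, 2 * s i ≤ n i) (ht : ∀ i, 2 * t i ≤ n i)
    (hn : ∀ i j, i ≠ j → 4 * n i ≤ 7 * n j)
    {A B : Finset (Finset (Σ i : Fin p, Fin (n i)))} (h : CrossIntersecting A B)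
    (hA : A ⊆ multiPart n t) (hB : B ⊆ multiPart n s) (hA2 : 2 ≤ #A) (hB2 : 2 ≤ #B) :
    pairWeight (multiPart n t) (multiPart n s) A B +
      #(multiPart n t) * ∏ i, (n i - t i).choose (s i) <
      #(multiPart n t) * #(multiPart n s) + max #(multiPart n t) #(multiPart n s) := by
  classical
  by_contra hcon
  push Not at hcon
  have hdual := card_mul_card_filter_disjoint hnst
  set X := multiPart n t with hX
  set Y := multiPart n s with hY
  set S : Finset (Finset (Finset (Σ i : Fin p, Fin (n i))) ×
      Finset (Finset (Σ i : Fin p, Fin (n i)))) :=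
    {q ∈ X.powerset ×ˢ Y.powerset | CrossIntersecting q.1 q.2 ∧ 2 ≤ #q.1 ∧ 2 ≤ #q.2} with hS
  have memS : ∀ q, q ∈ S ↔
      (q.1 ⊆ X ∧ q.2 ⊆ Y) ∧ CrossIntersecting q.1 q.2 ∧ 2 ≤ #q.1 ∧ 2 ≤ #q.2 := by
    simp [hS]
  obtain ⟨q, hqS, hq⟩ := exists_max_image S (fun q => pairWeight X Y q.1 q.2)
    ⟨(A, B), (memS _).2 ⟨⟨hA, hB⟩, h, hA2, hB2⟩⟩
  have hqge := hq (A, B) ((memS _).2 ⟨⟨hA, hB⟩, h, hA2, hB2⟩)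
  set V := pairWeight X Y q.1 q.2 with hV
  -- Pairs containing a singleton are not heavier than `V` either.
  have hmax : ∀ A' ⊆ X, ∀ B' ⊆ Y, A'.Nonempty → B'.Nonempty →
      CrossIntersecting A' B' → pairWeight X Y A' B' ≤ V := by
    intro A' hA' B' hB' hA'ne hB'ne hc
    have h1 := hA'ne.card_pos
    have h2 := hB'ne.card_pos
    by_cases hA1 : #A' = 1
    · obtain ⟨a, rfl⟩ := card_eq_one.1 hA1
      have := Nat.mul_le_mul_left #X (hc.card_add_le_of_singleton (hA' (mem_singleton_self a)) hB')
      have := le_max_right #X #Y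
      simp only [pairWeight, card_singleton] at hcon hqge ⊢
      nlinarith
    by_cases hB1 : #B' = 1
    · obtain ⟨b, rfl⟩ := card_eq_one.1 hB1
      have := Nat.mul_le_mul_left #Y
        (hc.symm.card_add_le_of_singleton (hB' (mem_singleton_self b)) hA')
      have := le_max_left #X #Y
      simp only [pairWeight, card_singleton] at hcon hqge ⊢
      nlinarith
    · exact hq (A', B') ((memS _).2 ⟨⟨hA', hB'⟩, hc, by dsimp only; omega, by dsimp only; omega⟩)
  set T := {r ∈ S | pairWeight X Y r.1 r.2 = V} with hT
  have hqT : q ∈ T := by simp [hT, hqS, hV]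
  obtain ⟨a, haT, ha⟩ := exists_min_image T (fun r => #r.1) ⟨q, hqT⟩
  obtain ⟨b, hbT, hb⟩ := exists_min_image T (fun r => #r.2) ⟨q, hqT⟩
  obtain ⟨haS, haV⟩ := mem_filter.1 haT
  obtain ⟨hbS, hbV⟩ := mem_filter.1 hbT
  rw [memS] at haS hbS
  have hcomm : ∀ A' B', pairWeight Y X B' A' = pairWeight X Y A' B' := fun A' B' => by
    simp only [pairWeight]; ring
  rcases le_total (#Y * #a.1) (#X * #b.2) with hle | hle
  · have hopt : IsMinimalOptimal n t s a.1 a.2 :=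
      { subset_left := haS.1.1
        subset_right := haS.1.2
        cross := haS.2.1
        two_le_left := haS.2.2.1
        two_le_right := haS.2.2.2
        weight_le := by rw [← hX, ← hY, haV]; exact hmax
        card_le := by
          rw [← hX, ← hY, haV]
          intro A' hA' B' hB' h1 h2 hc hw
          exact ha (A', B') (mem_filter.2 ⟨(memS _).2 ⟨⟨hA', hB'⟩, hc, h1, h2⟩, hw⟩)
        density_le := hle.trans (Nat.mul_le_mul_left _ (hb a haT)) }
    have := hopt.weight_add_lt hp hnst hs2 ht2 hs ht hn
    rw [← hX, ← hY, haV] at this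
    have := le_max_right #X #Y
    dsimp only at hqge
    omega
  · have hopt : IsMinimalOptimal n s t b.2 b.1 :=
      { subset_left := hbS.1.2
        subset_right := hbS.1.1
        cross := hbS.2.1.symm
        two_le_left := hbS.2.2.2
        two_le_right := hbS.2.2.1
        weight_le := by
          rw [← hX, ← hY, hcomm, hbV]
          intro B' hB' A' hA' h1 h2 hc
          rw [hcomm]
          exact hmax A' hA' B' hB' h2 h1 hc.symm
        card_le := by
          rw [← hX, ← hY, hcomm, hbV]
          intro B' hB' A' hA' h1 h2 hc hw
          rw [hcomm] at hw
          exact hb (A', B') (mem_filter.2 ⟨(memS _).2 ⟨⟨hA', hB'⟩, hc.symm, h2, h1⟩, hw⟩)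
        density_le := hle.trans (Nat.mul_le_mul_left _ (ha b hbT)) }
    have := hopt.weight_add_lt hp (fun i => by have := hnst i; omega) ht2 hs2 ht hs hn
    rw [← hX, ← hY, hcomm, hbV, ← hdual, mul_comm #Y] at this
    have := le_max_left #X #Y
    dsimp only at hqge
    omega

theorem theorem1p5 (p : ℕ) (hp : 2 ≤ p) (n s t : Fin p → ℕ)
    (hnst : ∀ i, s i + t i + 1 ≤ n i)
    (hs2 : ∀ i, 2 ≤ s i) (ht2 : ∀ i, 2 ≤ t i)
    (hs : ∀ i, (s i : ℚ) ≤ (n i : ℚ) / 2) (ht : ∀ i, (t i : ℚ) ≤ (n i : ℚ) / 2)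
    (hn : ∀ i j, i ≠ j → (n i : ℚ) ≤ 7 / 4 * (n j : ℚ))
    (hprod : ∏ i, (n i).choose (t i) ≤ ∏ i, (n i).choose (s i))
    (𝒜 ℬ : Finset (Finset (Σ i : Fin p, Fin (n i))))
    (h𝒜 : 𝒜 ⊆ multiPart n t) (hℬ : ℬ ⊆ multiPart n s)
    (h𝒜ne : 𝒜.Nonempty) (hℬne : ℬ.Nonempty)
    (hcross : CrossIntersecting 𝒜 ℬ) :
    (𝒜.card : ℤ) + (ℬ.card : ℤ) ≤
        (∏ i, ((n i).choose (s i) : ℤ)) - (∏ i, ((n i - t i).choose (s i) : ℤ)) + 1 ∧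
      ((𝒜.card : ℤ) + (ℬ.card : ℤ) =
          (∏ i, ((n i).choose (s i) : ℤ)) - (∏ i, ((n i - t i).choose (s i) : ℤ)) + 1 ↔
        (∃ A ∈ multiPart n t, 𝒜 = {A} ∧
            ℬ = (multiPart n s).filter fun B => (B ∩ A).Nonempty) ∨
        ((∏ i, (n i).choose (s i) = ∏ i, (n i).choose (t i)) ∧
          ∃ B ∈ multiPart n s, ℬ = {B} ∧
            𝒜 = (multiPart n t).filter fun A => (B ∩ A).Nonempty)) := by
  have hs' : ∀ i, 2 * s i ≤ n i := fun i => by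
    have := hs i
    have h2 : (2 * s i : ℚ) ≤ n i := by linarith
    exact_mod_cast h2
  have ht' : ∀ i, 2 * t i ≤ n i := fun i => by
    have := ht i
    have h2 : (2 * t i : ℚ) ≤ n i := by linarith
    exact_mod_cast h2
  have hn' : ∀ i j, i ≠ j → 4 * n i ≤ 7 * n j := fun i j hij => by
    have := hn i j hij
    have h2 : (4 * n i : ℚ) ≤ 7 * n j := by linarith
    exact_mod_cast h2
  have hdual := card_mul_card_filter_disjoint hnst
  have hmeet : ∀ A ∈ multiPart n t, #{B ∈ multiPart n s | (B ∩ A).Nonempty} +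
      ∏ i, (n i - t i).choose (s i) = #(multiPart n s) := fun A hA =>
    card_filter_inter_nonempty_add hA
  have hmeet' : ∀ B ∈ multiPart n s, #{A ∈ multiPart n t | (B ∩ A).Nonempty} +
      ∏ i, (n i - s i).choose (t i) = #(multiPart n t) := fun B hB => by
    simp_rw [inter_comm B]
    exact card_filter_inter_nonempty_add hB
  have hXY : #(multiPart n t) ≤ #(multiPart n s) := by
    rw [card_multiPart, card_multiPart]; exact hprod
  have hcast : (∏ i, ((n i).choose (s i) : ℤ)) = (#(multiPart n s) : ℤ) := by
    rw [card_multiPart]; push_cast; rfl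
  have hcast' : (∏ i, ((n i - t i).choose (s i) : ℤ)) =
      ((∏ i, (n i - t i).choose (s i) : ℕ) : ℤ) := by push_cast; rfl
  rw [hcast, hcast', ← card_multiPart n s, ← card_multiPart n t]
  have hA1 := h𝒜ne.card_pos
  have hB1 := hℬne.card_pos
  have hXpos : 0 < #(multiPart n t) := hA1.trans_le (card_le_card h𝒜)
  -- The members of a family meet every member of the other one.
  have hsubB : ∀ A ∈ 𝒜, ℬ ⊆ {B ∈ multiPart n s | (B ∩ A).Nonempty} := fun A hA B hB =>
    mem_filter.2 ⟨hℬ hB, by rw [inter_comm]; exact hcross A hA B hB⟩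
  have hsubA : ∀ B ∈ ℬ, 𝒜 ⊆ {A ∈ multiPart n t | (B ∩ A).Nonempty} := fun B hB A hA =>
    mem_filter.2 ⟨h𝒜 hA, by rw [inter_comm]; exact hcross A hA B hB⟩
  set d := ∏ i, (n i - t i).choose (s i) with hd
  set d' := ∏ i, (n i - s i).choose (t i) with hd'
  set X := #(multiPart n t) with hX
  set Y := #(multiPart n s) with hY
  -- The equality cases, in one direction.
  have hback : (∃ A ∈ multiPart n t, 𝒜 = {A} ∧
        ℬ = (multiPart n s).filter fun B => (B ∩ A).Nonempty) ∨
      ((Y = X) ∧ ∃ B ∈ multiPart n s, ℬ = {B} ∧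
        𝒜 = (multiPart n t).filter fun A => (B ∩ A).Nonempty) →
      (#𝒜 : ℤ) + (#ℬ : ℤ) = (Y : ℤ) - (d : ℤ) + 1 := by
    rintro (⟨A, hA, h1, h2⟩ | ⟨hYX, B, hB, h1, h2⟩)
    · have e1 := hmeet A hA
      rw [← h2] at e1
      have e2 : #𝒜 = 1 := by rw [h1, card_singleton]
      omega
    · have e1 := hmeet' B hB
      rw [← h2] at e1
      have e2 : #ℬ = 1 := by rw [h1, card_singleton]
      rw [hYX] at hdual
      have e3 := Nat.eq_of_mul_eq_mul_left hXpos hdual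
      omega
  have hgoal : #𝒜 + #ℬ + d ≤ Y + 1 ∧ (#𝒜 + #ℬ + d = Y + 1 →
      (∃ A ∈ multiPart n t, 𝒜 = {A} ∧
        ℬ = (multiPart n s).filter fun B => (B ∩ A).Nonempty) ∨
      ((Y = X) ∧ ∃ B ∈ multiPart n s, ℬ = {B} ∧
        𝒜 = (multiPart n t).filter fun A => (B ∩ A).Nonempty)) := by
    obtain ⟨A₀, hA₀⟩ := h𝒜ne
    obtain ⟨B₀, hB₀⟩ := hℬne
    have eB := card_le_card (hsubB A₀ hA₀)
    have eB' := hmeet A₀ (h𝒜 hA₀)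
    have eA := card_le_card (hsubA B₀ hB₀)
    have eA' := hmeet' B₀ (hℬ hB₀)
    by_cases hA2 : #𝒜 = 1
    · refine ⟨by omega, fun heq => Or.inl ⟨A₀, h𝒜 hA₀, ?_, ?_⟩⟩
      · obtain ⟨A, rfl⟩ := card_eq_one.1 hA2
        rw [mem_singleton.1 hA₀]
      · exact eq_of_subset_of_card_le (hsubB A₀ hA₀) (by omega)
    by_cases hB2 : #ℬ = 1
    · -- `|X| - d'` and `|Y| - d` are the same proportion of `|X|` and `|Y|`.
      have hm : 0 < #{A ∈ multiPart n t | (B₀ ∩ A).Nonempty} := by omega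
      have hprop : Y * #{A ∈ multiPart n t | (B₀ ∩ A).Nonempty} =
          X * #{B ∈ multiPart n s | (B ∩ A₀).Nonempty} := by
        have e1 : Y * (#{A ∈ multiPart n t | (B₀ ∩ A).Nonempty} + d') =
          X * (#{B ∈ multiPart n s | (B ∩ A₀).Nonempty} + d) := by rw [eA', eB', mul_comm]
        rw [mul_add, mul_add, hdual] at e1
        exact Nat.add_right_cancel e1
      have hle : #{A ∈ multiPart n t | (B₀ ∩ A).Nonempty} ≤
          #{B ∈ multiPart n s | (B ∩ A₀).Nonempty} := by
        refine Nat.le_of_mul_le_mul_left (?_ : X * _ ≤ X * _) hXpos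
        rw [← hprop]
        exact Nat.mul_le_mul_right _ hXY
      refine ⟨by omega, fun heq => Or.inr ⟨?_, B₀, hℬ hB₀, ?_, ?_⟩⟩
      · have e2 : #{A ∈ multiPart n t | (B₀ ∩ A).Nonempty} =
          #{B ∈ multiPart n s | (B ∩ A₀).Nonempty} := by omega
        rw [← e2] at hprop
        exact Nat.eq_of_mul_eq_mul_right hm hprop
      · obtain ⟨B, rfl⟩ := card_eq_one.1 hB2
        rw [mem_singleton.1 hB₀]
      · exact eq_of_subset_of_card_le (hsubA B₀ hB₀) (by omega)
    · -- Here the bound is strict.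
      have hlt := hcross.pairWeight_add_lt hp hnst hs2 ht2 hs' ht' hn' h𝒜 hℬ (by omega) (by omega)
      rw [← hX, ← hY, max_eq_right hXY, ← hd] at hlt
      simp only [pairWeight] at hlt
      rw [← hX, ← hY] at hlt
      have hstrict : #𝒜 + #ℬ + d < Y + 1 := by
        by_contra hcon
        push Not at hcon
        obtain ⟨x, hx⟩ : ∃ x, #𝒜 = x + 1 := ⟨#𝒜 - 1, by omega⟩
        obtain ⟨z, hz⟩ : ∃ z, Y = #ℬ + d + z := ⟨Y - (#ℬ + d), by omega⟩
        have h1 : X * z ≤ Y * x := Nat.mul_le_mul hXY (by omega)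
        have h2 : X * Y = X * #ℬ + X * d + X * z := by rw [hz]; ring
        rw [hx, h2] at hlt
        nlinarith
      exact ⟨hstrict.le, fun heq => absurd heq hstrict.ne⟩
  refine ⟨by omega, fun heq => hgoal.2 (by omega), hback⟩
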